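/- Let $\mu$ be the unique Borel probability measure on $\mathbb{R}$ such that $\mu(E)=\frac12\left(\mu(\tau_0^{-1}E)+\mu(\tau_2^{-1}E)\right)$ for all Borel sets $E\subset\mathbb{R}$, where $\tau_0(x)=\frac x4$ and $\tau_2(x)=\frac{x+2}4$. An odd natural number $m$ is called complete if, with $$\Gamma(m)=\left\{\sum_{k=0}^n 4^k l_k : n\ge 0,\ l_k\in\{0,m\}\right\},$$ the exponential functions $x\mapsto e^{2\pi i\lambda x}$, $\lambda\in\Gamma(m)$, form an orthonormal basis of the complex Hilbert space $L^2(\mu)$. Theorem. Let $m>3$ be an odd integer that is not divisible by $3$, and let $G_m=\{4^j \pmod m : j=0,1,2,\dots\}$ be the subgroup generated by $4$ in the group $U(\mathbb{Z}_m)$ of units of $\mathbb{Z}_m=\mathbb{Z}/m\mathbb{Z}$. (i) If at least one of the residue classes of $-1,-2,2,3$ modulo $m$ belongs to $G_m$, then $m$ is complete. (ii) If $m>12$ and at least one of the residue classes of $5,6,7,8,9,10,11,12$ modulo $m$ belongs to $G_m$, then $m$ is complete. -/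

import Mathlib

open MeasureTheory
open scoped ENNReal

noncomputable section

namespace CantorSpectrum

/-! ### The measure on the Cantor set with contraction ratio `1/4` -/

/-- The contraction `τ₀ x = x / 4`. -/
def tau0 (x : ℝ) : ℝ := x / 4

/-- The contraction `τ₂ x = (x + 2) / 4`. -/
def tau2 (x : ℝ) : ℝ := (x + 2) / 4

/-- The invariance equation `μ E = (μ (τ₀⁻¹ E) + μ (τ₂⁻¹ E)) / 2` for all Borel sets `E`. -/
def IsInvariant (μ : Measure ℝ) : Prop :=
  ∀ E : Set ℝ, MeasurableSet E →
    μ E = (1 / 2 : ℝ≥0∞) * (μ (tau0 ⁻¹' E) + μ (tau2 ⁻¹' E))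

/-- The fair coin on `Bool`. -/
def coin : Measure Bool :=
  (1 / 2 : ℝ≥0∞) • (Measure.dirac false + Measure.dirac true)

instance : IsProbabilityMeasure coin := by
  constructor
  simp [coin, ENNReal.inv_two_add_inv_two]

/-- The base-`4` digit attached to an outcome of the coin: `0` or `2`. -/
def digit (b : Bool) : ℝ := if b then 2 else 0

/-- The point `∑_{k ≥ 1} b_k / 4 ^ k` of the Cantor set with the digits `b_k ∈ {0, 2}`
(the digit `b_{k+1}` is `digit (ω k)`). -/
def cantorPoint (ω : ℕ → Bool) : ℝ := ∑' k : ℕ, digit (ω k) / 4 ^ (k + 1)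

/-- The invariant probability measure `μ` of the iterated function system `τ₀, τ₂`: the law of
the random series `∑_{k ≥ 1} b_k / 4 ^ k` with independent digits `b_k`, uniform on `{0, 2}`.
By `isInvariant_cantorMeasure` and `eq_cantorMeasure` below it is the unique Borel probability
measure on `ℝ` that satisfies the invariance equation. -/
def cantorMeasure : Measure ℝ :=
  (Measure.infinitePi fun _ : ℕ => coin).map cantorPoint

lemma digit_bound (b : Bool) (k : ℕ) : ‖digit b / 4 ^ (k + 1)‖ ≤ 2 * (1 / 4 : ℝ) ^ k := by
  have h : (0 : ℝ) < 4 ^ k := by positivity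
  cases b
  · simp [digit]
  · simp only [digit, if_true, pow_succ, norm_div, norm_mul, norm_pow, Real.norm_ofNat, one_div,
      inv_pow]
    rw [div_le_iff₀ (by positivity)]
    field_simp
    norm_num

lemma summable_bound : Summable fun k : ℕ => 2 * (1 / 4 : ℝ) ^ k :=
  (summable_geometric_of_lt_one (by norm_num) (by norm_num)).mul_left 2

lemma summable_digit (ω : ℕ → Bool) : Summable fun k : ℕ => digit (ω k) / (4 : ℝ) ^ (k + 1) :=
  Summable.of_norm_bounded summable_bound fun k => digit_bound (ω k) k

lemma measurable_cantorPoint : Measurable cantorPoint := by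
  have hd : Continuous digit := continuous_of_discreteTopology
  refine Continuous.measurable ?_
  refine continuous_tsum (fun k => ?_) summable_bound fun k ω => digit_bound (ω k) k
  exact (hd.comp (continuous_apply k)).div_const _

instance : IsProbabilityMeasure cantorMeasure :=
  Measure.isProbabilityMeasure_map measurable_cantorPoint.aemeasurable

/-- The sequence with first term `b` and tail `ω`. -/
def cons (b : Bool) (ω : ℕ → Bool) : ℕ → Bool := fun k => Nat.casesOn k b ω

lemma cantorPoint_cons (b : Bool) (ω : ℕ → Bool) :
    cantorPoint (cons b ω) = (cantorPoint ω + digit b) / 4 := by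
  unfold cantorPoint
  rw [(summable_digit (cons b ω)).tsum_eq_zero_add, add_div, ← tsum_div_const, add_comm]
  congr 1
  · refine tsum_congr fun k => ?_
    simp only [cons]
    rw [pow_succ 4 (k + 1), div_div]
  · simp [cons]

lemma measurable_cons (b : Bool) : Measurable (cons b) := by
  refine measurable_pi_lambda _ fun k => ?_
  cases k with
  | zero => exact measurable_const
  | succ k => exact measurable_pi_apply k

lemma infinitePi_coin_eq :
    (Measure.infinitePi fun _ : ℕ => coin) = (1 / 2 : ℝ≥0∞) •
      ((Measure.infinitePi fun _ : ℕ => coin).map (cons false) +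
        (Measure.infinitePi fun _ : ℕ => coin).map (cons true)) := by
  symm
  refine Measure.eq_infinitePi _ fun s t ht => ?_
  have hm : MeasurableSet (Set.pi (s : Set ℕ) t) :=
    MeasurableSet.pi s.countable_toSet fun i _ => ht i
  have key : ∀ b : Bool, (Measure.infinitePi fun _ : ℕ => coin).map (cons b) (Set.pi s t) =
      (if 0 ∈ s then (Measure.dirac b (t 0)) else 1) *
        ∏ i ∈ s.erase 0, coin (t i) := by
    intro b
    rw [Measure.map_apply (measurable_cons b) hm]
    set s' : Finset ℕ := (s.erase 0).image Nat.pred with hs'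
    have hinj : Set.InjOn Nat.pred (s.erase 0 : Set ℕ) := by
      intro x hx y hy hxy
      simp only [Finset.coe_erase, Set.mem_sdiff, Set.mem_singleton_iff] at hx hy
      simp only [Nat.pred_eq_sub_one] at hxy
      omega
    have hprod : ∏ i ∈ s.erase 0, coin (t i) = ∏ i ∈ s', coin (t (i + 1)) := by
      rw [hs', Finset.prod_image hinj]
      refine Finset.prod_congr rfl fun i hi => ?_
      rw [Nat.pred_eq_sub_one, Nat.sub_add_cancel (Nat.one_le_iff_ne_zero.2 (Finset.ne_of_mem_erase hi))]
    have hmem : ∀ i, i ∈ s' ↔ i + 1 ∈ s := by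
      intro i
      simp only [hs', Finset.mem_image, Finset.mem_erase]
      constructor
      · rintro ⟨j, ⟨hj0, hj⟩, rfl⟩
        rwa [Nat.pred_eq_sub_one, Nat.sub_add_cancel (Nat.one_le_iff_ne_zero.2 hj0)]
      · intro h
        exact ⟨i + 1, ⟨by omega, h⟩, rfl⟩
    have hpre : cons b ⁻¹' (Set.pi (s : Set ℕ) t) =
        {_ω | 0 ∈ s → b ∈ t 0} ∩ Set.pi (s' : Set ℕ) fun i => t (i + 1) := by
      ext ω
      simp only [Set.mem_preimage, Set.mem_pi, Finset.mem_coe, Set.mem_inter_iff,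
        Set.mem_ofPred_eq, hmem]
      constructor
      · intro h
        exact ⟨fun h0 => h 0 h0, fun i hi => h (i + 1) hi⟩
      · rintro ⟨h0, h1⟩ i hi
        cases i with
        | zero => exact h0 hi
        | succ i => exact h1 i hi
    rw [hpre, hprod, ← Measure.infinitePi_pi (μ := fun _ : ℕ => coin) (fun i _ => ht (i + 1))]
    by_cases h0 : 0 ∈ s
    · by_cases hb : b ∈ t 0 <;> simp [h0, hb]
    · simp [h0]
  simp only [Measure.smul_apply, Measure.add_apply, key, smul_eq_mul]
  by_cases h0 : 0 ∈ s
  · rw [← Finset.mul_prod_erase s _ h0]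
    simp only [h0, if_true, coin, Measure.smul_apply, Measure.add_apply, smul_eq_mul]
    ring
  · simp only [h0, if_false, Finset.erase_eq_of_notMem h0, one_mul]
    rw [← two_mul, ← mul_assoc, one_div, ENNReal.inv_mul_cancel (by norm_num) (by norm_num),
      one_mul]

lemma measurable_tau0 : Measurable tau0 := by unfold tau0; fun_prop

lemma measurable_tau2 : Measurable tau2 := by unfold tau2; fun_prop

/-- The measure satisfies the invariance equation. -/
theorem isInvariant_cantorMeasure : IsInvariant cantorMeasure := by
  intro E hE
  have h0 : cons false ⁻¹' (cantorPoint ⁻¹' E) = cantorPoint ⁻¹' (tau0 ⁻¹' E) := by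
    ext ω; simp [cantorPoint_cons, tau0, digit]
  have h2 : cons true ⁻¹' (cantorPoint ⁻¹' E) = cantorPoint ⁻¹' (tau2 ⁻¹' E) := by
    ext ω; simp [cantorPoint_cons, tau2, digit]
  have hE' := measurable_cantorPoint hE
  unfold cantorMeasure
  rw [Measure.map_apply measurable_cantorPoint hE,
    Measure.map_apply measurable_cantorPoint (measurable_tau0 hE),
    Measure.map_apply measurable_cantorPoint (measurable_tau2 hE), ← h0, ← h2]
  conv_lhs => rw [infinitePi_coin_eq]
  rw [Measure.smul_apply, Measure.add_apply, Measure.map_apply (measurable_cons _) hE',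
    Measure.map_apply (measurable_cons _) hE', smul_eq_mul]

lemma charFun_of_isInvariant {μ : Measure ℝ} [IsProbabilityMeasure μ] (h : IsInvariant μ)
    (t : ℝ) : charFun μ t =
      ((1 + Complex.exp ((t / 2 : ℝ) * Complex.I)) / 2) * charFun μ (t / 4) := by
  have hμ : μ = (1 / 2 : ℝ≥0∞) • (μ.map tau0 + μ.map tau2) := by
    ext E hE
    rw [Measure.smul_apply, Measure.add_apply, Measure.map_apply measurable_tau0 hE,
      Measure.map_apply measurable_tau2 hE, smul_eq_mul, h E hE]
  have hint : ∀ ν : Measure ℝ, IsProbabilityMeasure ν →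
      Integrable (fun x : ℝ => Complex.exp (t * x * Complex.I)) ν := by
    intro ν _
    refine Integrable.of_bound (C := 1) (by fun_prop) (Filter.Eventually.of_forall fun x => ?_)
    rw [← Complex.ofReal_mul, Complex.norm_exp_ofReal_mul_I]
  have i0 := hint _ (Measure.isProbabilityMeasure_map (μ := μ) measurable_tau0.aemeasurable)
  have i2 := hint _ (Measure.isProbabilityMeasure_map (μ := μ) measurable_tau2.aemeasurable)
  rw [charFun_apply_real, charFun_apply_real]
  conv_lhs => rw [hμ]
  rw [integral_smul_measure, integral_add_measure i0 i2,
    integral_map measurable_tau0.aemeasurable (by fun_prop),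
    integral_map measurable_tau2.aemeasurable (by fun_prop)]
  have e0 : ∀ x : ℝ, Complex.exp (t * (tau0 x : ℝ) * Complex.I) =
      Complex.exp ((t / 4 : ℝ) * x * Complex.I) := by
    intro x; congr 1; simp only [tau0]; push_cast; ring
  have e2 : ∀ x : ℝ, Complex.exp (t * (tau2 x : ℝ) * Complex.I) =
      Complex.exp ((t / 2 : ℝ) * Complex.I) * Complex.exp ((t / 4 : ℝ) * x * Complex.I) := by
    intro x; rw [← Complex.exp_add]; congr 1; simp only [tau2]; push_cast; ring
  simp only [e0, e2]
  rw [integral_const_mul]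
  simp only [one_div, ENNReal.toReal_inv, ENNReal.toReal_ofNat, Complex.real_smul,
    Complex.ofReal_inv, Complex.ofReal_ofNat]
  ring

/-- The invariance equation determines a Borel probability measure. -/
theorem eq_cantorMeasure {μ : Measure ℝ} [IsProbabilityMeasure μ] (h : IsInvariant μ) :
    μ = cantorMeasure := by
  refine Measure.ext_of_charFun (funext fun t => ?_)
  set D : ℝ → ℂ := fun t => charFun μ t - charFun cantorMeasure t with hD
  have hstep : ∀ t, ‖D t‖ ≤ ‖D (t / 4)‖ := by
    intro t
    simp only [hD]
    rw [charFun_of_isInvariant h, charFun_of_isInvariant isInvariant_cantorMeasure, ← mul_sub,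
      norm_mul]
    refine mul_le_of_le_one_left (norm_nonneg _) ?_
    rw [norm_div, Complex.norm_ofNat, div_le_one (by norm_num)]
    refine (norm_add_le _ _).trans ?_
    rw [Complex.norm_exp_ofReal_mul_I, norm_one]
    norm_num
  have hn : ∀ n : ℕ, ‖D t‖ ≤ ‖D (t / 4 ^ n)‖ := by
    intro n
    induction n with
    | zero => simp
    | succ n ih =>
      refine ih.trans ((hstep _).trans_eq ?_)
      rw [div_div, ← pow_succ]
  have hlim : Filter.Tendsto (fun n : ℕ => t / (4 : ℝ) ^ n) Filter.atTop (nhds 0) :=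
    tendsto_const_nhds.div_atTop (tendsto_pow_atTop_atTop_of_one_lt (by norm_num))
  have hc : Continuous fun t => ‖D t‖ := by
    have h1 : Continuous (charFun μ) := by fun_prop
    have h2 : Continuous (charFun cantorMeasure) := by fun_prop
    exact (h1.sub h2).norm
  have h0 : ‖D 0‖ = 0 := by simp [hD]
  have := ge_of_tendsto' ((hc.tendsto 0).comp hlim) hn
  rw [h0] at this
  exact sub_eq_zero.1 (norm_le_zero_iff.1 this)

/-! ### Spectra -/

/-- The exponential function `e_λ (x) = exp (2 π i λ x)`. -/
def expFun (l : ℝ) (x : ℝ) : ℂ := Complex.exp (2 * Real.pi * Complex.I * l * x)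

lemma memLp_expFun (l : ℝ) (μ : Measure ℝ) [IsFiniteMeasure μ] : MemLp (expFun l) 2 μ := by
  refine MemLp.of_bound (C := 1) (by unfold expFun; fun_prop)
    (Filter.Eventually.of_forall fun x => ?_)
  have : expFun l x = Complex.exp ((2 * Real.pi * l * x : ℝ) * Complex.I) := by
    unfold expFun; congr 1; push_cast; ring
  rw [this, Complex.norm_exp_ofReal_mul_I]

/-- The class of `e_λ` in the complex Hilbert space `L²(μ)`. -/
def expLp (μ : Measure ℝ) [IsFiniteMeasure μ] (l : ℝ) : Lp ℂ 2 μ :=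
  (memLp_expFun l μ).toLp (expFun l)

/-- `Γ ⊆ ℝ` is a spectrum for `μ`: the family `(e_λ)_{λ ∈ Γ}` is an orthonormal basis of
`L²(μ)`. -/
def IsSpectrum (Γ : Set ℝ) (μ : Measure ℝ) [IsFiniteMeasure μ] : Prop :=
  ∃ b : HilbertBasis Γ ℂ (Lp ℂ 2 μ), ∀ l : Γ, b l = expLp μ l

/-- `Γ(m) = {∑_{k=0}^n 4^k l_k : l_k ∈ {0, m}, n ∈ ℕ}`. -/
def Gam (m : ℕ) : Set ℝ :=
  {x | ∃ (n : ℕ) (l : ℕ → ℝ), (∀ k, l k = 0 ∨ l k = m) ∧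
    x = ∑ k ∈ Finset.range (n + 1), 4 ^ k * l k}

/-- The (odd) number `m` is complete: `Γ(m)` is a spectrum for the measure `μ`. -/
def IsCompleteNumber (m : ℕ) : Prop := IsSpectrum (Gam m) cantorMeasure

/-! ### The group generated by `4` -/

/-- `G_m`: the subgroup of the unit group `U(ℤ_m)` generated by (the residue class of) `4`. -/
def G (m : ℕ) : Subgroup (ZMod m)ˣ := Subgroup.closure {u | (u : ZMod m) = 4}

/-- The residue class of the integer `c` modulo `m` lies in `G_m`. -/
def MemG (m : ℕ) (c : ℤ) : Prop := ∃ u ∈ G m, (u : ZMod m) = (c : ZMod m)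

/-- `G_m = {4 ^ j mod m : j = 0, 1, …}` for odd `m`. -/
lemma memG_iff {m : ℕ} (hm : Odd m) (c : ℤ) :
    MemG m c ↔ ∃ j : ℕ, (4 : ZMod m) ^ j = (c : ZMod m) := by
  have : NeZero m := ⟨hm.pos.ne'⟩
  have hco : Nat.Coprime 4 m := by
    rw [show 4 = 2 ^ 2 by norm_num]
    exact (Nat.coprime_two_left.2 hm).pow_left 2
  set v : (ZMod m)ˣ := ZMod.unitOfCoprime 4 hco with hv
  have hv4 : (v : ZMod m) = 4 := by simp [hv]
  have hset : {u : (ZMod m)ˣ | (u : ZMod m) = 4} = {v} := by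
    ext u
    simp only [Set.mem_ofPred_eq, Set.mem_singleton_iff, ← hv4, Units.val_inj]
  have hG : G m = Subgroup.zpowers v := by
    rw [G, hset, Subgroup.zpowers_eq_closure]
  unfold MemG
  rw [hG]
  constructor
  · rintro ⟨u, hu, huc⟩
    obtain ⟨j, rfl⟩ := mem_powers_iff_mem_zpowers.2 hu
    exact ⟨j, by rw [← huc, Units.val_pow_eq_pow_val, hv4]⟩
  · rintro ⟨j, hj⟩
    exact ⟨v ^ j, Subgroup.npow_mem_zpowers v j, by rw [Units.val_pow_eq_pow_val, hv4, hj]⟩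

end CantorSpectrum

end

namespace CantorSpectrum

/-! ### Extreme cycles -/

section Cycles

variable {m : ℕ} {S : Set ℤ}

/-! Orthonormality holds because the Fourier transform of μ kills every nonzero difference in Γ(m)
(`fourierCantor_sub_eq_zero`). Completeness reduces to the bound h ≥ 1 for the Parseval sum h(t) = ∑
|μ̂(t + λ)|² (`isCompleteNumber_of_cycles`).

Splitting Γ(m) as 4Γ(m) ∪ (m + 4Γ(m)) gives h(t) = w(t) h(t/4) + w(t+m) h((t+m)/4) with w(t) +
w(t+m) = 1 (`parsevalSum_eq`). If h took a value below 1, its minimum set on a suitable compact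
interval would be closed, would omit 0, and would be stable under each of the two contractions
wherever its weight is nonzero. A non-integer point would flow to 0 under x ↦ x/4, so the set
consists of finitely many integers and contains a cycle of integers that omits 0
(`one_le_parsevalSum`).

Such cycles are excluded by arithmetic (`zero_mem_of_cycle`): they would lie in (0, m/3) and, modulo
m, be closed under multiplication by 4, hence by every class in `G m`. A small multiplier c moves a
well-chosen element to a residue with no representative available in the cycle. -/

lemma eq_zero_of_dvd_of_lt {d : ℤ} (h : (m : ℤ) ∣ d) (h1 : -(m : ℤ) < d) (h2 : d < m) : d = 0 :=
  Int.eq_zero_of_abs_lt_dvd h (abs_lt.2 ⟨h1, h2⟩)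

/-- A finite set of integers in which every `z` has a predecessor `4 z` or `4 z - m` lies in
`[0, m / 3]`. -/
lemma cycle_bounds (hfin : S.Finite) (hpred : ∀ z ∈ S, 4 * z ∈ S ∨ 4 * z - m ∈ S) {z : ℤ}
    (hz : z ∈ S) : 0 ≤ z ∧ 3 * z ≤ m := by
  obtain ⟨a, ha, hamin⟩ := S.exists_min_image id hfin ⟨z, hz⟩
  obtain ⟨b, hb, hbmax⟩ := S.exists_max_image id hfin ⟨z, hz⟩
  have h1 := hamin z hz
  have h2 := hbmax z hz
  simp only [id] at *
  constructor
  · rcases hpred a ha with h | h <;> have := hamin _ h <;> omega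
  · rcases hpred b hb with h | h <;> have := hbmax _ h <;> omega

/-- Both options in `hpred` are multiplication by 4 modulo m. -/
lemma cycle_pow (hpred : ∀ z ∈ S, 4 * z ∈ S ∨ 4 * z - m ∈ S) {z : ℤ} (hz : z ∈ S) (j : ℕ) :
    ∃ y ∈ S, (m : ℤ) ∣ y - 4 ^ j * z := by
  induction j with
  | zero => exact ⟨z, hz, by simp⟩
  | succ j ih =>
    obtain ⟨y, hy, k, hk⟩ := ih
    rcases hpred y hy with h | h
    · exact ⟨_, h, 4 * k, by rw [pow_succ]; linear_combination 4 * hk⟩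
    · exact ⟨_, h, 4 * k - 1, by rw [pow_succ]; linear_combination 4 * hk⟩

lemma cycle_mul (hodd : Odd m) (hpred : ∀ z ∈ S, 4 * z ∈ S ∨ 4 * z - m ∈ S) {c : ℤ}
    (hc : MemG m c) {z : ℤ} (hz : z ∈ S) : ∃ y ∈ S, (m : ℤ) ∣ y - c * z := by
  obtain ⟨j, hj⟩ := (memG_iff hodd c).1 hc
  obtain ⟨y, hy, hd⟩ := cycle_pow hpred hz j
  refine ⟨y, hy, ?_⟩
  have h4 : (m : ℤ) ∣ 4 ^ j - c := by
    rw [← ZMod.intCast_zmod_eq_zero_iff_dvd]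
    push_cast
    rw [hj, sub_self]
  have := dvd_add hd (h4.mul_right z)
  rwa [show y - 4 ^ j * z + (4 ^ j - c) * z = y - c * z by ring] at this

/-- If one of the listed residue classes is in `G m`, then every cycle contains `0`. -/
lemma zero_mem_of_cycle (hodd : Odd m) (h3 : ¬ 3 ∣ m) (hfin : S.Finite) (hne : S.Nonempty)
    (hpred : ∀ z ∈ S, 4 * z ∈ S ∨ 4 * z - m ∈ S) {c : ℤ} (hc : MemG m c)
    (hcs : c = -1 ∨ c = -2 ∨ c = 2 ∨ c = 3 ∨ 5 ≤ c ∧ c ≤ 12) : 0 ∈ S := by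
  by_contra h0
  have hpos : ∀ z ∈ S, 0 < z := fun z hz =>
    lt_of_le_of_ne (cycle_bounds hfin hpred hz).1 (by rintro rfl; exact h0 hz)
  -- Strictness comes from `h3`: 3z = m is impossible.
  have hlt : ∀ z ∈ S, 3 * z < m := fun z hz => by
    have := (cycle_bounds hfin hpred hz).2
    omega
  have hmul : ∀ z ∈ S, ∃ y ∈ S, (m : ℤ) ∣ y - c * z := fun z hz => cycle_mul hodd hpred hc hz
  obtain ⟨b, hb, hbmax⟩ := S.exists_max_image id hfin hne
  obtain ⟨a, ha, hamin⟩ := S.exists_min_image id hfin hne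
  simp only [id] at hbmax hamin
  obtain ⟨y, hy, hd⟩ := hmul b hb
  have hb1 := hpos b hb
  have hb2 := hlt b hb
  have hy1 := hpos y hy
  have hy2 := hlt y hy
  have hyb := hbmax y hy
  -- With y in (0, b] and 3b < m, the multiple y - cb of m lies strictly between -m and m, yet it is
  -- positive for c = -1, -2 and negative for c = 2, 3.
  rcases hcs with rfl | rfl | rfl | rfl | ⟨hc5, hc12⟩
  · have := eq_zero_of_dvd_of_lt hd (by omega) (by omega); omega
  · have := eq_zero_of_dvd_of_lt hd (by omega) (by omega); omega
  · have := eq_zero_of_dvd_of_lt hd (by omega) (by omega); omega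
  · have := eq_zero_of_dvd_of_lt hd (by omega) (by omega); omega
  clear hd hy1 hy2 hyb hy y
  -- By minimality 4a - m < a is not in the cycle, so 4a is, and 4a < m/3.
  have ha12 : 12 * a < m := by
    rcases hpred a ha with h | h
    · have := hlt _ h; omega
    · have := hamin _ h; have := hlt a ha; omega
  -- The largest element x below m/12 is trapped in (m/16, m/12): 4x is in the cycle but not below
  -- m/12, so 16x is too large and 16x - m must be a positive element.
  obtain ⟨x, ⟨hx, hx12⟩, hxmax⟩ := (S ∩ {z | 12 * z < m}).exists_max_image id
    (hfin.inter_of_left _) ⟨a, ha, ha12⟩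
  simp only [id, Set.mem_inter_iff, Set.mem_ofPred_eq, and_imp] at hx12 hxmax
  have hx1 := hpos x hx
  have h16 : m < 16 * x := by
    have h4 : 4 * x ∈ S := (hpred x hx).resolve_right fun h => by
      have := hpos _ h; omega
    have h12 : ¬ 12 * (4 * x) < m := fun h => by have := hxmax _ h4 h; omega
    rcases hpred _ h4 with h | h
    · have := hlt _ h; omega
    · have := hpos _ h; omega
  obtain ⟨y, hy, hd⟩ := hmul x hx
  have hy1 := hpos y hy
  have hy2 := hlt y hy
  have hcx : 5 * x ≤ c * x := by gcongr
  have hcx' : c * x ≤ 12 * x := by gcongr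
  -- Since 5m/16 < cx < m and 0 < y < m/3, the congruence is the equality y = cx; then cx < m/3 and
  -- x > m/16 force c < 16/3.
  have hyc := eq_zero_of_dvd_of_lt hd (by omega) (by omega)
  have hc6 : c < 6 := by
    by_contra! h
    have : 6 * x ≤ c * x := by gcongr
    omega
  obtain rfl : c = 5 := by omega
  -- For c = 5 multiply again: 25x - m lies between 9m/16 and 2m/3, so it is congruent to no w in
  -- (0, m/3).
  obtain ⟨w, hw, hd⟩ := hmul y hy
  have hw1 := hpos w hw
  have hw2 := hlt w hw
  have := eq_zero_of_dvd_of_lt (dvd_add hd (dvd_refl (m : ℤ))) (by omega) (by omega)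
  omega

/-- A set of integers that is finite and on which `4 z' ∈ {z, z + m}` always has a solution `z'`
contains a cycle. -/
lemma exists_cycle (hfin : S.Finite) (hne : S.Nonempty)
    (hsucc : ∀ z ∈ S, ∃ y ∈ S, 4 * y = z ∨ 4 * y = z + m) :
    ∃ T ⊆ S, T.Nonempty ∧ ∀ z ∈ T, 4 * z ∈ T ∨ 4 * z - m ∈ T := by
  -- An orbit of a successor map on a finite set is eventually periodic; its periodic tail is the
  -- cycle.
  choose! f hfS hf using hsucc
  obtain ⟨z, hz⟩ := hne
  have hmem : ∀ n, f^[n] z ∈ S := fun n => by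
    induction n with
    | zero => exact hz
    | succ n ih => rw [Function.iterate_succ_apply']; exact hfS _ ih
  have : ∃ i j, i < j ∧ f^[i] z = f^[j] z := by
    have := hfin.to_subtype
    obtain ⟨i, j, hij, h⟩ :=
      Finite.exists_ne_map_eq_of_infinite fun n : ℕ => (⟨f^[n] z, hmem n⟩ : S)
    simp only [Subtype.mk.injEq] at h
    rcases lt_or_gt_of_ne hij with h' | h'
    · exact ⟨i, j, h', h⟩
    · exact ⟨j, i, h', h.symm⟩
  obtain ⟨i, j, hij, heq⟩ := this
  have hper : ∀ n, i ≤ n → f^[n] z = f^[n + (j - i)] z := fun n hn => by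
    obtain ⟨k, rfl⟩ := Nat.exists_eq_add_of_le' hn
    rw [show k + i + (j - i) = k + j by omega, Function.iterate_add_apply,
      Function.iterate_add_apply, heq]
  refine ⟨{x | ∃ n, i ≤ n ∧ x = f^[n] z}, ?_, ⟨_, i, le_rfl, rfl⟩, ?_⟩
  · rintro _ ⟨n, -, rfl⟩
    exact hmem n
  · rintro _ ⟨n, hn, rfl⟩
    -- Going one period ahead before stepping back keeps the index at least i, even when n = i.
    have hs : f^[n] z = f (f^[n + (j - i) - 1] z) := by
      rw [hper n hn, ← Function.iterate_succ_apply' f]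
      congr 2
      omega
    have hle : i ≤ n + (j - i) - 1 := by omega
    rcases hf _ (hmem (n + (j - i) - 1)) with h | h
    · exact Or.inl ⟨_, hle, by rw [hs, h]⟩
    · exact Or.inr ⟨_, hle, by rw [hs, h]; ring⟩

end Cycles

/-! ### The Fourier transform of the Cantor measure -/

section Fourier

/-- The Fourier transform `t ↦ ∫ exp (2 π i t x) dμ(x)` of the Cantor measure. -/
noncomputable def fourierCantor (t : ℝ) : ℂ := charFun cantorMeasure (2 * Real.pi * t)

lemma continuous_fourierCantor : Continuous fourierCantor := by
  have h : Continuous (charFun cantorMeasure) := by fun_prop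
  exact h.comp (by fun_prop)

lemma fourierCantor_zero : fourierCantor 0 = 1 := by simp [fourierCantor]

lemma fourierCantor_eq (t : ℝ) : fourierCantor t =
    (1 + Complex.exp ((Real.pi * t : ℝ) * Complex.I)) / 2 * fourierCantor (t / 4) := by
  unfold fourierCantor
  rw [charFun_of_isInvariant isInvariant_cantorMeasure]
  congr 3
  · congr 3; ring
  · ring

lemma norm_sq_one_add_exp_div_two (x : ℝ) :
    ‖(1 + Complex.exp (x * Complex.I)) / 2‖ ^ 2 = (1 + Real.cos x) / 2 := by
  rw [← Complex.normSq_eq_norm_sq, map_div₀, Complex.normSq_ofNat, Complex.normSq_apply]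
  simp only [Complex.add_re, Complex.add_im, Complex.one_re, Complex.one_im,
    Complex.exp_ofReal_mul_I_re, Complex.exp_ofReal_mul_I_im]
  linear_combination (1 / 4 : ℝ) * Real.sin_sq_add_cos_sq x

/-- The squared modulus of the low-pass filter of the Cantor measure. -/
noncomputable def weight (t : ℝ) : ℝ≥0∞ := ENNReal.ofReal ((1 + Real.cos (Real.pi * t)) / 2)

lemma half_one_add_cos_nonneg (x : ℝ) : 0 ≤ (1 + Real.cos x) / 2 := by
  linarith [Real.neg_one_le_cos x]

lemma weight_add_four_mul_int (t : ℝ) (n : ℤ) : weight (t + 4 * n) = weight t := by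
  unfold weight
  rw [show Real.pi * (t + 4 * n) = Real.pi * t + (2 * n : ℤ) * (2 * Real.pi) by push_cast; ring,
    Real.cos_add_int_mul_two_pi]

/-- Translation by an odd m changes the sign of cos(πt). -/
lemma weight_add_weight {m : ℕ} (hodd : Odd m) (t : ℝ) : weight t + weight (t + m) = 1 := by
  unfold weight
  rw [← ENNReal.ofReal_add (half_one_add_cos_nonneg _) (half_one_add_cos_nonneg _), mul_add,
    Real.cos_add, mul_comm Real.pi (m : ℝ), Real.cos_nat_mul_pi, Real.sin_nat_mul_pi,
    hodd.neg_one_pow, ← ENNReal.ofReal_one]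
  congr 1
  ring

/-- The filter vanishes exactly at the odd integers. -/
lemma weight_eq_zero_iff (t : ℝ) : weight t = 0 ↔ ∃ n : ℤ, t = 2 * n + 1 := by
  have h : weight t = 0 ↔ Real.cos (Real.pi * t - Real.pi) = 1 := by
    unfold weight
    rw [ENNReal.ofReal_eq_zero, Real.cos_sub_pi]
    have := Real.neg_one_le_cos (Real.pi * t)
    constructor <;> intro _ <;> linarith
  rw [h, Real.cos_eq_one_iff]
  have hpi := Real.pi_ne_zero
  refine exists_congr fun n => ⟨fun h => ?_, fun h => ?_⟩
  · apply mul_left_cancel₀ hpi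
    linear_combination -h
  · rw [h]; ring

/-- The squared modulus of the Fourier transform of the Cantor measure. -/
noncomputable def powerSpectrum (t : ℝ) : ℝ≥0∞ := ENNReal.ofReal (‖fourierCantor t‖ ^ 2)

lemma powerSpectrum_eq (t : ℝ) : powerSpectrum t = weight t * powerSpectrum (t / 4) := by
  unfold powerSpectrum weight
  rw [fourierCantor_eq, norm_mul, mul_pow, norm_sq_one_add_exp_div_two,
    ENNReal.ofReal_mul (half_one_add_cos_nonneg _)]

lemma powerSpectrum_eq_zero_iff (t : ℝ) : powerSpectrum t = 0 ↔ fourierCantor t = 0 := by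
  unfold powerSpectrum
  rw [ENNReal.ofReal_eq_zero]
  constructor
  · intro h
    have := le_antisymm h (sq_nonneg _)
    simpa using this
  · intro h; simp [h]

lemma lowerSemicontinuous_powerSpectrum (a : ℝ) :
    LowerSemicontinuous fun t => powerSpectrum (t + a) := by
  refine Continuous.lowerSemicontinuous ?_
  have := continuous_fourierCantor
  exact ENNReal.continuous_ofReal.comp (by fun_prop)

end Fourier

/-! ### The set `Γ(m)` -/

section Gam

variable {m : ℕ}

lemma zero_mem_Gam : (0 : ℝ) ∈ Gam m := ⟨0, fun _ => 0, fun _ => Or.inl rfl, by simp⟩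

lemma add_four_mul_mem_Gam {a g : ℝ} (ha : a = 0 ∨ a = m) (hg : g ∈ Gam m) :
    a + 4 * g ∈ Gam m := by
  obtain ⟨n, l, hl, rfl⟩ := hg
  refine ⟨n + 1, fun k => Nat.casesOn k a l, fun k => ?_, ?_⟩
  · cases k with
    | zero => exact ha
    | succ k => exact hl k
  · rw [Finset.sum_range_succ' _ (n + 1), Finset.mul_sum, add_comm]
    simp only [pow_zero, one_mul]
    congr 1
    exact Finset.sum_congr rfl fun k _ => by ring

lemma exists_eq_add_four_mul {x : ℝ} (hx : x ∈ Gam m) :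
    ∃ a, (a = 0 ∨ a = (m : ℝ)) ∧ ∃ g ∈ Gam m, x = a + 4 * g := by
  obtain ⟨n, l, hl, rfl⟩ := hx
  refine ⟨l 0, hl 0, ?_⟩
  cases n with
  | zero => exact ⟨0, zero_mem_Gam, by simp⟩
  | succ n =>
    refine ⟨_, ⟨n, fun k => l (k + 1), fun k => hl _, rfl⟩, ?_⟩
    rw [Finset.sum_range_succ', Finset.mul_sum, add_comm]
    simp only [pow_zero, one_mul]
    congr 1
    exact Finset.sum_congr rfl fun k _ => by ring

lemma exists_int_of_mem_Gam {x : ℝ} (hx : x ∈ Gam m) : ∃ n : ℤ, x = n := by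
  obtain ⟨n, l, hl, rfl⟩ := hx
  choose z hz using fun k => show ∃ z : ℤ, l k = z from
    (hl k).elim (fun h => ⟨0, by simp [h]⟩) fun h => ⟨m, by simp [h]⟩
  exact ⟨∑ k ∈ Finset.range (n + 1), 4 ^ k * z k, by push_cast; simp only [hz]⟩

lemma Gam_eq_union : Gam m = (fun g => 4 * g) '' Gam m ∪ (fun g => (m : ℝ) + 4 * g) '' Gam m := by
  ext x
  constructor
  · intro hx
    obtain ⟨a, rfl | rfl, g, hg, rfl⟩ := exists_eq_add_four_mul hx
    · exact Or.inl ⟨g, hg, by simp⟩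
    · exact Or.inr ⟨g, hg, rfl⟩
  · rintro (⟨g, hg, rfl⟩ | ⟨g, hg, rfl⟩)
    · simpa using add_four_mul_mem_Gam (Or.inl rfl) hg
    · exact add_four_mul_mem_Gam (Or.inr rfl) hg

lemma disjoint_Gam (hodd : Odd m) :
    Disjoint ((fun g => 4 * g) '' Gam m) ((fun g => (m : ℝ) + 4 * g) '' Gam m) := by
  rw [Set.disjoint_left]
  rintro _ ⟨g, hg, rfl⟩ ⟨g', hg', h⟩
  simp only at h
  obtain ⟨n, rfl⟩ := exists_int_of_mem_Gam hg
  obtain ⟨n', rfl⟩ := exists_int_of_mem_Gam hg'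
  obtain ⟨k, rfl⟩ := hodd
  have : ((2 * k + 1 : ℕ) : ℤ) + 4 * n' = 4 * n := by exact_mod_cast h
  omega

/-- The Fourier transform of the Cantor measure vanishes on the nonzero differences of `Γ(m)`. -/
lemma fourierCantor_sub_eq_zero (hodd : Odd m) {x y : ℝ} (hx : x ∈ Gam m) (hy : y ∈ Gam m)
    (hne : x ≠ y) : fourierCantor (x - y) = 0 := by
  -- Induction on the size of the difference: equal lowest digits allow division by 4, while
  -- different ones make the difference odd, where the filter vanishes.
  obtain ⟨k, hk⟩ : ∃ k : ℕ, |x - y| < 4 ^ k := pow_unbounded_of_one_lt _ (by norm_num)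
  rw [← powerSpectrum_eq_zero_iff]
  induction k generalizing x y with
  | zero =>
    obtain ⟨n, rfl⟩ := exists_int_of_mem_Gam hx
    obtain ⟨n', rfl⟩ := exists_int_of_mem_Gam hy
    have : |n - n'| < 1 := by exact_mod_cast hk
    rw [Int.abs_lt_one_iff] at this
    exact absurd (by rw [sub_eq_zero.1 this]) hne
  | succ k ih =>
    obtain ⟨a, ha, g, hg, rfl⟩ := exists_eq_add_four_mul hx
    obtain ⟨b, hb, h, hh, rfl⟩ := exists_eq_add_four_mul hy
    rw [powerSpectrum_eq]
    by_cases hab : a = b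
    · subst hab
      have e : a + 4 * g - (a + 4 * h) = 4 * (g - h) := by ring
      rw [e] at hk ⊢
      rw [mul_div_cancel_left₀ _ (by norm_num : (4 : ℝ) ≠ 0), ih hg hh (by rintro rfl; simp at hne),
        mul_zero]
      rw [abs_mul, abs_of_pos (by norm_num : (0 : ℝ) < 4), pow_succ] at hk
      linarith
    · obtain ⟨n, rfl⟩ := exists_int_of_mem_Gam hg
      obtain ⟨n', rfl⟩ := exists_int_of_mem_Gam hh
      obtain ⟨q, rfl⟩ := hodd
      rw [(weight_eq_zero_iff _).2, zero_mul]
      rcases ha with rfl | rfl <;> rcases hb with rfl | rfl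
      · simp at hab
      · exact ⟨2 * n - 2 * n' - q - 1, by push_cast; ring⟩
      · exact ⟨2 * n - 2 * n' + q, by push_cast; ring⟩
      · simp at hab

end Gam

/-! ### The Parseval sum -/

section Parseval

variable {m : ℕ}

/-- The sum of `|∫ exp (2 π i (t + λ) x) dμ(x)|²` over `λ ∈ Γ(m)`. -/
noncomputable def parsevalSum (m : ℕ) (t : ℝ) : ℝ≥0∞ := ∑' g : Gam m, powerSpectrum (t + g)

/-- Enough to attain a minimum on compact sets and to have closed sublevel sets; continuity of the
sum is not needed. -/
lemma lowerSemicontinuous_parsevalSum : LowerSemicontinuous (parsevalSum m) :=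
  lowerSemicontinuous_tsum fun g => lowerSemicontinuous_powerSpectrum g

lemma one_le_parsevalSum_zero : 1 ≤ parsevalSum m 0 := by
  refine le_trans ?_ (ENNReal.le_tsum (⟨0, zero_mem_Gam⟩ : Gam m))
  simp [powerSpectrum, fourierCantor_zero]

lemma tsum_powerSpectrum_add (t : ℝ) :
    ∑' g : Gam m, powerSpectrum (t + 4 * g) = weight t * parsevalSum m (t / 4) := by
  unfold parsevalSum
  rw [← ENNReal.tsum_mul_left]
  refine tsum_congr fun g => ?_
  obtain ⟨n, hn⟩ := exists_int_of_mem_Gam g.2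
  rw [powerSpectrum_eq, hn, weight_add_four_mul_int]
  congr 2
  ring

lemma parsevalSum_eq (hodd : Odd m) (t : ℝ) : parsevalSum m t =
    weight t * parsevalSum m (t / 4) + weight (t + m) * parsevalSum m ((t + m) / 4) := by
  have h4 : Function.Injective fun g : ℝ => 4 * g := fun a b h => by simpa using h
  have hm4 : Function.Injective fun g : ℝ => (m : ℝ) + 4 * g := fun a b h => by simpa using h
  conv_lhs =>
    rw [parsevalSum, Gam_eq_union, Summable.tsum_union_disjoint (f := fun g => powerSpectrum (t + g))
      (disjoint_Gam hodd) ENNReal.summable ENNReal.summable,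
      tsum_image (fun g => powerSpectrum (t + g)) h4.injOn,
      tsum_image (fun g => powerSpectrum (t + g)) hm4.injOn]
  simp only [← add_assoc]
  rw [tsum_powerSpectrum_add, tsum_powerSpectrum_add]

/-- Minimum principle: if an average of values is at most a lower bound q, any value of nonzero
weight is at most q. -/
lemma le_of_weighted_sum_eq {a b A B q : ℝ≥0∞} (hab : a + b = 1) (ha : a ≠ 0) (hq : q ≠ ∞)
    (hB : q ≤ B) (h : a * A + b * B ≤ q) : A ≤ q := by
  by_contra! hA
  have hat : a ≠ ∞ := ne_top_of_le_ne_top ENNReal.one_ne_top (hab ▸ le_self_add)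
  have hbt : b ≠ ∞ := ne_top_of_le_ne_top ENNReal.one_ne_top (hab ▸ le_add_self)
  have h1 : a * q < a * A := ENNReal.mul_lt_mul_right ha hat hA
  have h2 : b * q ≤ b * B := by gcongr
  have := ENNReal.add_lt_add_of_lt_of_le (ENNReal.mul_ne_top hbt hq) h1 h2
  rw [← add_mul, hab, one_mul] at this
  exact absurd h this.not_ge

/-- If all cycles contain `0`, then the Parseval sum is at least `1` everywhere. -/
theorem one_le_parsevalSum (hodd : Odd m)
    (hcyc : ∀ S : Set ℤ, S.Finite → S.Nonempty → (∀ z ∈ S, 4 * z ∈ S ∨ 4 * z - m ∈ S) → 0 ∈ S)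
    (t : ℝ) : 1 ≤ parsevalSum m t := by
  -- R ≥ |t| puts t in the interval, and R ≥ m makes it invariant under both contractions.
  set R : ℝ := |t| + m with hR
  have htR : t ∈ Set.Icc (-R) R := by
    rw [Set.mem_Icc, ← abs_le, hR]
    linarith [(Nat.cast_nonneg m : (0 : ℝ) ≤ m)]
  have hm0 : (0 : ℝ) ≤ m := Nat.cast_nonneg m
  have hmR : (m : ℝ) ≤ R := by linarith [abs_nonneg t]
  obtain ⟨p, hp, hmin⟩ := LowerSemicontinuousOn.exists_isMinOn ⟨t, htR⟩ isCompact_Icc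
    ((lowerSemicontinuous_parsevalSum (m := m)).lowerSemicontinuousOn _)
  rw [isMinOn_iff] at hmin
  set q := parsevalSum m p with hq
  by_contra! hlt
  have hq1 : q < 1 := (hmin t htR).trans_lt hlt
  set M : Set ℝ := Set.Icc (-R) R ∩ {x | parsevalSum m x ≤ q} with hM
  have hMclosed : IsClosed M :=
    isClosed_Icc.inter (lowerSemicontinuous_parsevalSum.isClosed_preimage q)
  have h0M : (0 : ℝ) ∉ M := fun h => (one_le_parsevalSum_zero.trans h.2).not_gt hq1
  have hmem0 : ∀ x ∈ Set.Icc (-R) R, x / 4 ∈ Set.Icc (-R) R := fun x hx => by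
    rw [Set.mem_Icc] at *; constructor <;> linarith
  have hmemm : ∀ x ∈ Set.Icc (-R) R, (x + m) / 4 ∈ Set.Icc (-R) R := fun x hx => by
    rw [Set.mem_Icc] at *; constructor <;> linarith
  have step0 : ∀ x ∈ M, weight x ≠ 0 → x / 4 ∈ M := fun x hx hw =>
    ⟨hmem0 x hx.1, le_of_weighted_sum_eq (weight_add_weight hodd x) hw hq1.ne_top
      (hmin _ (hmemm x hx.1)) ((parsevalSum_eq hodd x).symm.trans_le hx.2)⟩
  have stepm : ∀ x ∈ M, weight (x + m) ≠ 0 → (x + m) / 4 ∈ M := fun x hx hw =>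
    ⟨hmemm x hx.1, le_of_weighted_sum_eq ((add_comm _ _).trans (weight_add_weight hodd x)) hw
      hq1.ne_top (hmin _ (hmem0 x hx.1))
      ((add_comm _ _).trans_le ((parsevalSum_eq hodd x).symm.trans_le hx.2))⟩
  have hint : ∀ x ∈ M, ∃ z : ℤ, x = z := by
    by_contra! h
    obtain ⟨x, hx, hxz⟩ := h
    -- The filter vanishes only at odd integers, so x/4ⁿ, never an integer, can always be divided by
    -- 4 inside M.
    have key : ∀ n : ℕ, x / 4 ^ n ∈ M ∧ ∀ z : ℤ, x / 4 ^ n ≠ z := by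
      intro n
      induction n with
      | zero => simpa using ⟨hx, hxz⟩
      | succ n ih =>
        rw [pow_succ, ← div_div]
        refine ⟨step0 _ ih.1 fun h => ?_, fun z hz => ih.2 (4 * z) ?_⟩
        · obtain ⟨k, hk⟩ := (weight_eq_zero_iff _).1 h
          exact ih.2 (2 * k + 1) (by push_cast; exact hk)
        · push_cast; linarith
    have hlim : Filter.Tendsto (fun n : ℕ => x / (4 : ℝ) ^ n) Filter.atTop (nhds 0) :=
      tendsto_const_nhds.div_atTop (tendsto_pow_atTop_atTop_of_one_lt (by norm_num))
    exact h0M (hMclosed.mem_of_tendsto hlim (Filter.Eventually.of_forall fun n => (key n).1))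
  set S : Set ℤ := {z | (z : ℝ) ∈ M} with hS
  have hSfin : S.Finite := by
    refine (Set.finite_Icc (⌈-R⌉) ⌊R⌋).subset fun z hz => ?_
    exact ⟨Int.ceil_le.2 hz.1.1, Int.le_floor.2 hz.1.2⟩
  have hSne : S.Nonempty := by
    have hpM : p ∈ M := ⟨hp, hq.ge⟩
    obtain ⟨z, hz⟩ := hint p hpM
    exact ⟨z, show (z : ℝ) ∈ M from hz ▸ hpM⟩
  have hsucc : ∀ z ∈ S, ∃ y ∈ S, 4 * y = z ∨ 4 * y = z + m := by
    intro z hz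
    -- Parity selects a branch of nonzero weight; divisibility by 4 then follows from M consisting
    -- of integers.
    rcases Int.even_or_odd' z with ⟨k, hk | hk⟩
    · have hmem := step0 z hz fun h => by
        obtain ⟨n, hn⟩ := (weight_eq_zero_iff _).1 h
        have : z = 2 * n + 1 := by exact_mod_cast hn
        omega
      obtain ⟨y, hy⟩ := hint _ hmem
      refine ⟨y, show (y : ℝ) ∈ M from hy ▸ hmem, Or.inl ?_⟩
      have : (4 : ℝ) * y = z := by linarith
      exact_mod_cast this
    · have hmem := stepm z hz fun h => by
        obtain ⟨n, hn⟩ := (weight_eq_zero_iff _).1 h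
        have : z + m = 2 * n + 1 := by exact_mod_cast hn
        obtain ⟨j, hj⟩ := hodd
        omega
      obtain ⟨y, hy⟩ := hint _ hmem
      refine ⟨y, show (y : ℝ) ∈ M from hy ▸ hmem, Or.inr ?_⟩
      have : (4 : ℝ) * y = z + m := by linarith
      exact_mod_cast this
  obtain ⟨T, hTS, hTne, hT⟩ := exists_cycle hSfin hSne hsucc
  have h0 := hTS (hcyc T (hSfin.subset hTS) hTne hT)
  exact h0M (by simpa [hS] using h0)

end Parseval

/-! ### Exponentials in `L²(μ)` -/

section Exponentials

lemma expFun_eq (l x : ℝ) : expFun l x = Complex.exp ((2 * Real.pi * l : ℝ) * x * Complex.I) := by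
  unfold expFun; congr 1; push_cast; ring

lemma star_expFun (l x : ℝ) : (starRingEnd ℂ) (expFun l x) = expFun (-l) x := by
  rw [expFun_eq, expFun_eq, ← Complex.exp_conj]
  congr 1
  simp only [map_mul, Complex.conj_ofReal, Complex.conj_I]
  push_cast
  ring

lemma inner_expLp (a b : ℝ) :
    inner ℂ (expLp cantorMeasure a) (expLp cantorMeasure b) = fourierCantor (b - a) := by
  rw [L2.inner_def, fourierCantor, charFun_apply_real]
  refine integral_congr_ae ?_
  filter_upwards [(memLp_expFun a cantorMeasure).coeFn_toLp,
    (memLp_expFun b cantorMeasure).coeFn_toLp] with x ha hb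
  unfold expLp
  rw [ha, hb, RCLike.inner_apply, star_expFun, expFun_eq, expFun_eq, ← Complex.exp_add]
  congr 1
  push_cast
  ring

lemma norm_expLp (a : ℝ) : ‖expLp cantorMeasure a‖ = 1 := by
  rw [norm_eq_sqrt_re_inner (𝕜 := ℂ), inner_expLp, sub_self, fourierCantor_zero,
    RCLike.one_re, Real.sqrt_one]

/-- A real integrable function whose Fourier transform vanishes is zero almost everywhere. -/
lemma ae_eq_zero_of_fourier_eq_zero {μ : Measure ℝ} {u : ℝ → ℝ} (hu : Integrable u μ)
    (h : ∀ t : ℝ, ∫ x, (u x : ℂ) * Complex.exp (t * x * Complex.I) ∂μ = 0) : u =ᵐ[μ] 0 := by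
  have hu' : Integrable (fun x => -u x) μ := hu.neg
  have hpos : Integrable (fun x => max (u x) 0) μ := hu.pos_part
  have hneg : Integrable (fun x => max (-u x) 0) μ := hu.neg_part
  set ν₁ := μ.withDensity fun x => ENNReal.ofReal (u x) with hν₁
  set ν₂ := μ.withDensity fun x => ENNReal.ofReal (-u x) with hν₂
  have : IsFiniteMeasure ν₁ := isFiniteMeasure_withDensity_ofReal hu.2
  have : IsFiniteMeasure ν₂ := isFiniteMeasure_withDensity_ofReal hu'.2
  have hchar : ∀ {v : ℝ → ℝ}, Integrable v μ → ∀ t : ℝ,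
      charFun (μ.withDensity fun x => ENNReal.ofReal (v x)) t =
        ∫ x, ((max (v x) 0 : ℝ) : ℂ) * Complex.exp (t * x * Complex.I) ∂μ := by
    intro v hv t
    rw [charFun_apply_real, integral_withDensity_eq_integral_toReal_smul₀
      hv.1.aemeasurable.ennreal_ofReal (by simp)]
    refine integral_congr_ae (Filter.Eventually.of_forall fun x => ?_)
    simp only [ENNReal.toReal_ofReal', Complex.real_smul]
  have hint : ∀ {v : ℝ → ℝ}, Integrable v μ → ∀ t : ℝ,
      Integrable (fun x => (v x : ℂ) * Complex.exp (t * x * Complex.I)) μ := by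
    intro v hv t
    refine hv.ofReal.mul_bdd (c := 1) (by fun_prop) (Filter.Eventually.of_forall fun x => ?_)
    rw [← Complex.ofReal_mul, Complex.norm_exp_ofReal_mul_I]
  -- The positive and negative parts of u define finite measures with the same characteristic
  -- function.
  have hν : ν₁ = ν₂ := by
    refine Measure.ext_of_charFun (funext fun t => ?_)
    rw [← sub_eq_zero, hν₁, hν₂, hchar hu, hchar hu', ← integral_sub (hint hpos t) (hint hneg t),
      ← h t]
    refine integral_congr_ae (Filter.Eventually.of_forall fun x => ?_)
    simp only [← sub_mul, ← Complex.ofReal_sub]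
    congr 2
    rcases le_total (u x) 0 with h0 | h0
    · rw [max_eq_right h0, max_eq_left (by linarith)]; ring
    · rw [max_eq_left h0, max_eq_right (by linarith)]; ring
  have hae := (withDensity_eq_iff hu.1.aemeasurable.ennreal_ofReal
    hu'.1.aemeasurable.ennreal_ofReal hu.lintegral_lt_top.ne).1 hν
  filter_upwards [hae] with x hx
  simp only [Pi.zero_apply]
  rcases lt_trichotomy (u x) 0 with h0 | h0 | h0
  · rw [ENNReal.ofReal_of_nonpos h0.le, eq_comm, ENNReal.ofReal_eq_zero] at hx
    linarith
  · exact h0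
  · rw [ENNReal.ofReal_of_nonpos (by linarith : -u x ≤ 0), ENNReal.ofReal_eq_zero] at hx
    linarith

/-- The exponentials are total in `L²(μ)`. -/
lemma eq_zero_of_inner_expLp_eq_zero (f : Lp ℂ 2 cantorMeasure)
    (h : ∀ t : ℝ, inner ℂ (expLp cantorMeasure t) f = 0) : f = 0 := by
  have hf : Integrable f cantorMeasure := (Lp.memLp f).integrable (by norm_num)
  have hint : ∀ t : ℝ, Integrable (fun x : ℝ => f x * Complex.exp (t * x * Complex.I))
      cantorMeasure := by
    intro t
    refine hf.mul_bdd (c := 1) (by fun_prop) (Filter.Eventually.of_forall fun x => ?_)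
    rw [← Complex.ofReal_mul, Complex.norm_exp_ofReal_mul_I]
  have hint' : ∀ t : ℝ, Integrable
      (fun x : ℝ => (starRingEnd ℂ) (f x) * Complex.exp (t * x * Complex.I)) cantorMeasure := by
    intro t
    refine (Complex.conjLIE.integrable_comp_iff.2 hf).mul_bdd (c := 1) (by fun_prop)
      (Filter.Eventually.of_forall fun x => ?_)
    rw [← Complex.ofReal_mul, Complex.norm_exp_ofReal_mul_I]
  have h1 : ∀ t : ℝ, ∫ x, f x * Complex.exp (t * x * Complex.I) ∂cantorMeasure = 0 := by
    intro t
    rw [← h (-(t / (2 * Real.pi))), L2.inner_def]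
    refine integral_congr_ae ?_
    filter_upwards [(memLp_expFun (-(t / (2 * Real.pi))) cantorMeasure).coeFn_toLp] with x hx
    unfold expLp
    rw [hx, RCLike.inner_apply, star_expFun, expFun_eq]
    congr 4
    have := Real.pi_ne_zero
    field_simp
  have h2 : ∀ t : ℝ, ∫ x, (starRingEnd ℂ) (f x) * Complex.exp (t * x * Complex.I)
      ∂cantorMeasure = 0 := by
    intro t
    -- The transform of the conjugate of f at t is the conjugate of the transform of f at -t.
    rw [← (starRingEnd ℂ).injective.eq_iff, map_zero, ← integral_conj, ← h1 (-t)]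
    refine integral_congr_ae (Filter.Eventually.of_forall fun x => ?_)
    simp [← Complex.exp_conj]
  have hre : (fun x => (f x).re) =ᵐ[cantorMeasure] 0 := by
    refine ae_eq_zero_of_fourier_eq_zero hf.re fun t => ?_
    have e : ∀ x : ℝ, ((f x).re : ℂ) * Complex.exp (t * x * Complex.I) =
        (1 / 2) * (f x * Complex.exp (t * x * Complex.I) +
          (starRingEnd ℂ) (f x) * Complex.exp (t * x * Complex.I)) := fun x => by
      rw [Complex.re_eq_add_conj]; ring
    simp only [e]
    rw [integral_const_mul, integral_add (hint t) (hint' t), h1, h2]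
    simp
  have him : (fun x => (f x).im) =ᵐ[cantorMeasure] 0 := by
    refine ae_eq_zero_of_fourier_eq_zero hf.im fun t => ?_
    have e : ∀ x : ℝ, ((f x).im : ℂ) * Complex.exp (t * x * Complex.I) =
        (1 / (2 * Complex.I)) * (f x * Complex.exp (t * x * Complex.I) -
          (starRingEnd ℂ) (f x) * Complex.exp (t * x * Complex.I)) := fun x => by
      rw [Complex.im_eq_sub_conj]; ring
    simp only [e]
    rw [integral_const_mul, integral_sub (hint t) (hint' t), h1, h2]
    simp
  rw [Lp.eq_zero_iff_ae_eq_zero]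
  filter_upwards [hre, him] with x hr hi
  exact Complex.ext hr hi

end Exponentials

/-! ### Completeness -/

section Completeness

variable {m : ℕ}

lemma orthonormal_expLp (hodd : Odd m) :
    Orthonormal ℂ fun g : Gam m => expLp cantorMeasure g := by
  refine ⟨fun g => norm_expLp _, fun g h hne => ?_⟩
  simp only [inner_expLp]
  exact fourierCantor_sub_eq_zero hodd h.2 g.2 fun e => hne (Subtype.ext e.symm)

/-- A vector for which Bessel's inequality is an equality is orthogonal to every vector that is
orthogonal to the orthonormal family. -/
lemma inner_eq_zero_of_norm_sq_le_tsum {E ι : Type*} [NormedAddCommGroup E]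
    [InnerProductSpace ℂ E] {e : ι → E} (he : Orthonormal ℂ e) {v f : E}
    (hf : ∀ i, inner ℂ (e i) f = 0) (hv : ‖v‖ ^ 2 ≤ ∑' i, ‖inner ℂ (e i) v‖ ^ 2) :
    inner ℂ v f = 0 := by
  by_contra hne
  have hf0 : f ≠ 0 := by rintro rfl; simp at hne
  have hff : inner ℂ f f ≠ 0 := inner_self_ne_zero.2 hf0
  -- Removing the component along f keeps all coefficients of v. Bessel for w gives ‖v‖ ≤ ‖w‖,
  -- against Pythagoras if that component is nonzero.
  set w := v - (inner ℂ f v / inner ℂ f f) • f with hw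
  have hfw : inner ℂ f w = 0 := by
    rw [hw, inner_sub_right, inner_smul_right, div_mul_cancel₀ _ hff, sub_self]
  have hew : ∀ i, inner ℂ (e i) w = inner ℂ (e i) v := fun i => by
    rw [hw, inner_sub_right, inner_smul_right, hf, mul_zero, sub_zero]
  have hbessel := he.tsum_inner_products_le w
  simp only [hew] at hbessel
  have hvw : v = w + (inner ℂ f v / inner ℂ f f) • f := by rw [hw]; abel
  have hpyth := norm_add_sq_eq_norm_sq_add_norm_sq_of_inner_eq_zero w
    ((inner ℂ f v / inner ℂ f f) • f) (by
      rw [inner_smul_right, ← inner_conj_symm w f, hfw, map_zero, mul_zero])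
  rw [← hvw] at hpyth
  have hfv : inner ℂ f v ≠ 0 := fun h => hne (by rw [← inner_conj_symm, h, map_zero])
  have : 0 < ‖(inner ℂ f v / inner ℂ f f) • f‖ :=
    norm_pos_iff.2 (smul_ne_zero (div_ne_zero hfv hff) hf0)
  nlinarith

/-- If all cycles contain `0`, then `m` is complete. -/
theorem isCompleteNumber_of_cycles (hodd : Odd m)
    (hcyc : ∀ S : Set ℤ, S.Finite → S.Nonempty → (∀ z ∈ S, 4 * z ∈ S ∨ 4 * z - m ∈ S) → 0 ∈ S) :
    IsCompleteNumber m := by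
  have hon := orthonormal_expLp hodd
  have hbot : (Submodule.span ℂ (Set.range fun g : Gam m => expLp cantorMeasure g))ᗮ = ⊥ := by
    rw [Submodule.eq_bot_iff]
    intro f hf
    rw [Submodule.mem_orthogonal] at hf
    refine eq_zero_of_inner_expLp_eq_zero f fun t =>
      inner_eq_zero_of_norm_sq_le_tsum hon (fun g => hf _ (Submodule.subset_span ⟨g, rfl⟩)) ?_
    -- The Parseval sum at -t is the sum of squared coefficients of the exponential at t, a unit
    -- vector.
    have h1 := one_le_parsevalSum hodd hcyc (-t)
    have e : ∀ g : Gam m, powerSpectrum (-t + g) =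
        ENNReal.ofReal (‖inner ℂ (expLp cantorMeasure t) (expLp cantorMeasure g)‖ ^ 2) := by
      intro g
      rw [inner_expLp, powerSpectrum, neg_add_eq_sub]
    simp only [parsevalSum, e, norm_inner_symm (expLp cantorMeasure t)] at h1
    rw [← ENNReal.ofReal_tsum_of_nonneg (fun _ => sq_nonneg _)
      (hon.inner_products_summable (expLp cantorMeasure t)), ENNReal.one_le_ofReal] at h1
    rwa [norm_expLp, one_pow]
  exact ⟨HilbertBasis.mkOfOrthogonalEqBot hon hbot, fun g => by
    rw [HilbertBasis.coe_mkOfOrthogonalEqBot]⟩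

end Completeness

end CantorSpectrum

theorem theorem2p6 (m : ℕ) (hm : 3 < m) (hodd : Odd m) (h3 : ¬ 3 ∣ m) :
    ((∃ c ∈ ({-1, -2, 2, 3} : Set ℤ), CantorSpectrum.MemG m c) →
      CantorSpectrum.IsCompleteNumber m) ∧
    (12 < m → (∃ c ∈ ({5, 6, 7, 8, 9, 10, 11, 12} : Set ℤ), CantorSpectrum.MemG m c) →
      CantorSpectrum.IsCompleteNumber m) := by
  constructor
  · rintro ⟨c, hc, hcG⟩
    refine CantorSpectrum.isCompleteNumber_of_cycles hodd fun S hfin hne hpred =>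
      CantorSpectrum.zero_mem_of_cycle hodd h3 hfin hne hpred hcG ?_
    simp only [Set.mem_insert_iff, Set.mem_singleton_iff] at hc
    omega
  · rintro - ⟨c, hc, hcG⟩
    refine CantorSpectrum.isCompleteNumber_of_cycles hodd fun S hfin hne hpred =>
      CantorSpectrum.zero_mem_of_cycle hodd h3 hfin hne hpred hcG ?_
    simp only [Set.mem_insert_iff, Set.mem_singleton_iff] at hc
    omega
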